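/- Let $\rho>0$ and let $M\ge 0$ be an integer. For an integer $N\ge 1$, a vector $\mathbf c=(c_0,\dots,c_{N-1})\in(0,\infty)^N$ and an integer $D\ge N$ put $$\mathcal C(\mathbf c;z^{D};N,\rho):=\sum_{j=0}^{N-1}\binom{D}{j}^2\binom{D-j-1}{N-j-1}^2\frac{\rho^{D-j}}{c_j}.$$ For $K\subset\mathbb C$ let $\mathcal P_N(K)$ be the set of positive semidefinite Hermitian $N\times N$ matrices with entries in $K$, and let $\overline D(0,\rho)\subset\mathbb C$ be the closed disc of radius $\rho$ centred at $0$. For $A=(a_{ij})\in\mathcal P_N(\overline D(0,\rho))$ write $A^{\circ k}=(a_{ij}^k)$ (so $A^{\circ 0}$ is the all-ones matrix), and set $$A_0:=\sum_{j=0}^{N-1}c_jA^{\circ j},\qquad A_m:=A^{\circ(N-1+m)}\quad(1\le m\le M+1),$$ $$\mathcal U_A[\eta]:=\Bigl\{A_0+\sum_{m=1}^{M+1}u_mA_m:\ u_m\in[-\eta,\eta]\Bigr\}\qquad(\eta>0).$$ 1. For all $N\ge1$, $\mathbf c\in(0,\infty)^N$ and $\eta>0$, $$\eta\le\Bigl(\sum_{m=0}^{M}\mathcal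 C(\mathbf c;z^{N+m};N,\rho)\Bigr)^{-1}\ \Longrightarrow\ \mathcal U_A[\eta]\subset\mathcal P_N(\mathbb C)\ \text{ for every } A\in\mathcal P_N(\overline D(0,\rho)),$$ and, conversely, if $\mathcal U_A[\eta]\subset\mathcal P_N(\mathbb C)$ for every $A\in\mathcal P_N(\overline D(0,\rho))$, then $$\eta\le\mathcal C(\mathbf c;z^{N+M};N,\rho)^{-1}.$$ 2. The two bounds are asymptotically equal as $N\to\infty$, with $\rho$ and $M$ fixed: for every choice of vectors $\mathbf c^{(N)}\in(0,\infty)^N$ $(N\ge1)$, $$\lim_{N\to\infty}\mathcal C(\mathbf c^{(N)};z^{N+M};N,\rho)^{-1}\sum_{m=0}^{M}\mathcal C(\mathbf c^{(N)};z^{N+m};N,\rho)=1.$$ -/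

import Mathlib

open scoped ComplexOrder

namespace HadamardCube

/-- `psdCone N K`: the set of positive semidefinite (Hermitian) `N × N` complex matrices all of
whose entries lie in `K ⊆ ℂ`. -/
def psdCone (N : ℕ) (K : Set ℂ) : Set (Matrix (Fin N) (Fin N) ℂ) :=
  {A | A.PosSemidef ∧ ∀ i j, A i j ∈ K}

/-- The entrywise (Hadamard) power `A^{∘k} = (a_{ij}^k)`; `A^{∘0}` is the all-ones matrix. -/
def hadamardPow {N : ℕ} (A : Matrix (Fin N) (Fin N) ℂ) (k : ℕ) : Matrix (Fin N) (Fin N) ℂ :=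
  Matrix.of fun i j => A i j ^ k

/-- The matrix `c_0 𝟏 + c_1 A + ⋯ + c_{N-1} A^{∘(N-1)}`. -/
noncomputable def lowerPart {N : ℕ} (c : Fin N → ℝ) (A : Matrix (Fin N) (Fin N) ℂ) :
    Matrix (Fin N) (Fin N) ℂ :=
  ∑ j : Fin N, c j • hadamardPow A (j : ℕ)

/-- The matrix cube `{A₀ + ∑ m, u_m A_m : u_m ∈ [-η, η]}` with `k` directions
`A_m`, indexed by `Fin k`. -/
def matrixCube {N k : ℕ} (A₀ : Matrix (Fin N) (Fin N) ℂ)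
    (A : Fin k → Matrix (Fin N) (Fin N) ℂ) (η : ℝ) : Set (Matrix (Fin N) (Fin N) ℂ) :=
  {B | ∃ u : Fin k → ℝ, (∀ m, u m ∈ Set.Icc (-η) η) ∧ B = A₀ + ∑ m, u m • A m}

/-- The matrix cube with `A₀ = ∑_{j<N} c_j A^{∘j}` and directions
`A^{∘N}, A^{∘(N+1)}, …, A^{∘(N+M)}`. -/
def hadamardCube {N : ℕ} (M : ℕ) (c : Fin N → ℝ) (A : Matrix (Fin N) (Fin N) ℂ) (η : ℝ) :
    Set (Matrix (Fin N) (Fin N) ℂ) :=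
  matrixCube (lowerPart c A) (fun m : Fin (M + 1) => hadamardPow A (N + (m : ℕ))) η

/-- The constant `𝒞(c; z^D; N, ρ) = ∑_{j=0}^{N-1} C(D,j)² C(D-j-1,N-j-1)² ρ^{D-j} / c_j`,
for degrees `D ≥ N` (so that none of the natural-number subtractions truncates). -/
noncomputable def threshold {N : ℕ} (c : Fin N → ℝ) (D : ℕ) (ρ : ℝ) : ℝ :=
  ∑ j : Fin N, ((D.choose (j : ℕ) : ℝ)) ^ 2 *
    (((D - (j : ℕ) - 1).choose (N - (j : ℕ) - 1) : ℕ) : ℝ) ^ 2 * (ρ ^ (D - (j : ℕ)) / c j)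

end HadamardCube

/-! Everything reduces to one monomial: `t * ∑ c_j A^{∘j} - A^{∘D}` is positive semidefinite once
`t` reaches the threshold. For `A = v v*` its quadratic form at `x` is `t * ∑ c_j |y_j|² - |y_D|²`
with `y_k = x* v^k`. Reducing `z^D` modulo `∏ (z - v_i)` gives `y_D = ∑ a_j y_j`, and weighted
Cauchy–Schwarz bounds `|y_D|²` by `(∑ |a_j|² / c_j) * ∑ c_j |y_j|²`. Up to sign the `a_j` are hook
Schur polynomials in `v`. Their coefficients are nonnegative, so they are largest when every `v_i`
equals `√ρ` (`norm_powRem_coeff_le`), and the first factor is then the threshold.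

Higher rank follows FitzGerald and Horn: write `A = v v* + B` with the zeroth row of `B` zero and
differentiate along `v v* + s B`. The derivative is a Hadamard product of `B` with the same problem
in size `N - 1` and degree `D - 1`, so induction and the Schur product theorem apply
(`posSemidef_thresholdPoly`).

Adding the inequalities for `D = N, …, N + M` gives the first bound. The converse uses nodes tending
to `√ρ` and the equality case of Cauchy–Schwarz. For the limit, raising the degree by one multiplies
the threshold by at least a constant times `N²`, uniformly in `c`. -/

namespace HadamardCube

/-! ### Remainders of powers and sharp bounds on their coefficients. -/

open Polynomial in
/-- The remainder of `X ^ (n + m)` modulo `∏ i ≤ n, (X - z i)`. -/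
noncomputable def powRem {R : Type*} [CommRing R] (z : ℕ → R) : ℕ → ℕ → R[X]
  | 0, m => C (z 0 ^ m)
  | n + 1, 0 => X ^ (n + 1)
  | n + 1, m + 1 => C (z (n + 1)) * powRem z (n + 1) m
      + (X - C (z (n + 1))) * powRem z n (m + 1)

/-- The recursion is a Newton step: at the new node the second summand vanishes, and at an old node
the two terms in `z (n + 1)` cancel. Nodes may repeat. -/
theorem powRem_eval {R : Type*} [CommRing R] (z : ℕ → R) (n m i : ℕ) (hi : i ≤ n) :
    (powRem z n m).eval (z i) = z i ^ (n + m) := by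
  induction n, m using powRem.induct with
  | case1 m => obtain rfl : i = 0 := by omega
               simp [powRem]
  | case2 n => simp [powRem]
  | case3 n m ih1 ih2 =>
    rw [powRem]
    rcases Nat.lt_or_ge n i with h | h
    · obtain rfl : i = n + 1 := by omega
      simp [ih1 hi]; ring
    · simp [ih1 hi, ih2 h]; ring

/-- The coefficients, up to sign, of `powRem` at the all-ones vector. -/
def hookDim (n m j : ℕ) : ℕ := (n + m).choose j * (n + m - j - 1).choose (n - j)

theorem hookDim_zero_left (m : ℕ) : hookDim 0 m 0 = 1 := by simp [hookDim]

theorem hookDim_zero_right {n j : ℕ} (hj : j ≤ n) :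
    hookDim n 0 j = if j = n then 1 else 0 := by
  split_ifs with h
  · subst h; simp [hookDim]
  · simp only [hookDim, add_zero, Nat.mul_eq_zero]
    right
    exact Nat.choose_eq_zero_of_lt (by omega)

/-- This and the next two recursions are those of the coefficients of `powRem` at all-ones nodes
with the signs removed; each is Pascal's rule. -/
theorem hookDim_succ_zero (n m : ℕ) :
    hookDim (n + 1) (m + 1) 0 = hookDim (n + 1) m 0 + hookDim n (m + 1) 0 := by
  simp only [hookDim, Nat.choose_zero_right, one_mul, Nat.sub_zero]
  rw [show n + 1 + (m + 1) - 1 = (n + m) + 1 by omega, show n + 1 + m - 1 = n + m by omega,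
    show n + (m + 1) - 1 = n + m by omega, Nat.choose_succ_succ]
  ring

theorem hookDim_succ_succ {n j : ℕ} (m : ℕ) (hj : j + 1 ≤ n) :
    hookDim (n + 1) (m + 1) (j + 1) = hookDim (n + 1) m (j + 1) + hookDim n (m + 1) j
      + hookDim n (m + 1) (j + 1) := by
  obtain ⟨k, rfl⟩ := Nat.exists_eq_add_of_le hj
  simp only [hookDim]
  rw [show j + 1 + k + 1 + (m + 1) = (j + k + m + 2) + 1 by omega,
    show j + k + m + 2 + 1 - (j + 1) - 1 = (k + m) + 1 by omega,
    show j + 1 + k + 1 - (j + 1) = k + 1 by omega,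
    show j + 1 + k + 1 + m = j + k + m + 2 by omega,
    show j + k + m + 2 - (j + 1) - 1 = k + m by omega,
    show j + 1 + k + (m + 1) = j + k + m + 2 by omega,
    show j + 1 + k - j = k + 1 by omega,
    show j + 1 + k - (j + 1) = k by omega,
    show j + k + m + 2 - j - 1 = k + m + 1 by omega,
    show j + k + m + 2 - (j + 1) - 1 = k + m by omega,
    Nat.choose_succ_succ (j + k + m + 2) j, Nat.choose_succ_succ (k + m) k]
  ring

/-- The top index is separate because truncated subtraction makes `hookDim n (m + 1) (n + 1)`
nonzero, whereas the coefficient it should bound is zero. -/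
theorem hookDim_succ_top (n m : ℕ) :
    hookDim (n + 1) (m + 1) (n + 1) = hookDim (n + 1) m (n + 1) + hookDim n (m + 1) n := by
  simp only [hookDim, Nat.sub_self, Nat.choose_zero_right, mul_one]
  rw [show n + 1 + (m + 1) = (n + 1 + m) + 1 by omega, show n + (m + 1) = n + 1 + m by omega,
    Nat.choose_succ_succ]
  ring

theorem powRem_coeff_eq_zero {R : Type*} [CommRing R] (z : ℕ → R) (n m j : ℕ) (hj : n < j) :
    (powRem z n m).coeff j = 0 := by
  induction n, m using powRem.induct generalizing j with
  | case1 m => rw [powRem, Polynomial.coeff_C_of_ne_zero (by omega)]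
  | case2 n => rw [powRem, Polynomial.coeff_X_pow, if_neg (by omega)]
  | case3 n m ih1 ih2 =>
    obtain ⟨j, rfl⟩ : ∃ i, j = i + 1 := ⟨j - 1, by omega⟩
    simp [powRem, sub_mul, Polynomial.coeff_X_mul, ih1 _ hj, ih2 j (by omega),
      ih2 (j + 1) (by omega)]

theorem powRem_eval_eq_sum {R : Type*} [CommRing R] (z : ℕ → R) (n m : ℕ) (x : R) :
    (powRem z n m).eval x = ∑ j ∈ Finset.range (n + 1), (powRem z n m).coeff j * x ^ j := by
  refine Polynomial.eval_eq_sum_range' ?_ x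
  refine Nat.lt_succ_of_le (Polynomial.natDegree_le_iff_coeff_eq_zero.2 fun j hj => ?_)
  exact powRem_coeff_eq_zero z n m j hj

theorem powRem_coeff_zero {R : Type*} [CommRing R] (z : ℕ → R) (n m : ℕ) :
    (powRem z (n + 1) (m + 1)).coeff 0 = z (n + 1) * (powRem z (n + 1) m).coeff 0
      - z (n + 1) * (powRem z n (m + 1)).coeff 0 := by
  simp [powRem, sub_mul, Polynomial.mul_coeff_zero]; ring

theorem powRem_coeff_succ {R : Type*} [CommRing R] (z : ℕ → R) (n m j : ℕ) :
    (powRem z (n + 1) (m + 1)).coeff (j + 1) = z (n + 1) * (powRem z (n + 1) m).coeff (j + 1)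
      + (powRem z n (m + 1)).coeff j - z (n + 1) * (powRem z n (m + 1)).coeff (j + 1) := by
  simp [powRem, sub_mul, Polynomial.coeff_X_mul]; ring

/-- The triangle inequality in the coefficient recursion reproduces the recursion of `hookDim`. -/
theorem norm_powRem_coeff_le (z : ℕ → ℂ) (r : ℝ) (n m j : ℕ) (hz : ∀ i ≤ n, ‖z i‖ ≤ r)
    (hj : j ≤ n) : ‖(powRem z n m).coeff j‖ ≤ hookDim n m j * r ^ (n + m - j) := by
  have hr : 0 ≤ r := (norm_nonneg _).trans (hz 0 (Nat.zero_le _))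
  induction n, m using powRem.induct generalizing j with
  | case1 m =>
    obtain rfl : j = 0 := by omega
    rw [powRem, Polynomial.coeff_C_zero]
    simpa [hookDim_zero_left] using pow_le_pow_left₀ (norm_nonneg _) (hz 0 le_rfl) m
  | case2 n =>
    rw [powRem, Polynomial.coeff_X_pow, hookDim_zero_right hj]
    split_ifs with h <;> simp [h]
  | case3 n m ih1 ih2 =>
    simp only [Nat.succ_eq_add_one] at *
    have hz' : ∀ i ≤ n, ‖z i‖ ≤ r := fun i hi => hz i (by omega)
    have h0 := hz (n + 1) le_rfl
    rcases j with _ | j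
    · have h1 := ih1 0 hz (by omega)
      have h2 := ih2 0 hz' (by omega)
      rw [powRem_coeff_zero, hookDim_succ_zero]
      calc _ ≤ ‖z (n + 1)‖ * ‖(powRem z (n + 1) m).coeff 0‖
            + ‖z (n + 1)‖ * ‖(powRem z n (m + 1)).coeff 0‖ := by
            rw [← norm_mul, ← norm_mul]; exact norm_sub_le _ _
        _ ≤ r * (hookDim (n + 1) m 0 * r ^ (n + 1 + m - 0))
            + r * (hookDim n (m + 1) 0 * r ^ (n + (m + 1) - 0)) := by gcongr
        _ = _ := by push_cast; simp only [Nat.sub_zero]; ring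
    · have e1 : n + 1 + (m + 1) - (j + 1) = n + m + 1 - j := by omega
      have e2 : n + 1 + m - (j + 1) = n + m - j := by omega
      have e3 : n + (m + 1) - j = n + m + 1 - j := by omega
      have e4 : n + (m + 1) - (j + 1) = n + m - j := by omega
      have e5 : n + m + 1 - j = n + m - j + 1 := by omega
      have h1 := ih1 (j + 1) hz hj
      have h2 := ih2 j hz' (by omega)
      rw [powRem_coeff_succ]
      rw [e2] at h1
      rw [e3, e5] at h2
      rw [e1, e5]
      rcases Nat.lt_or_ge n (j + 1) with h | h
      · obtain rfl : j = n := by omega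
        rw [powRem_coeff_eq_zero z j (m + 1) (j + 1) (by omega), mul_zero, sub_zero,
          hookDim_succ_top]
        calc _ ≤ ‖z (j + 1)‖ * ‖(powRem z (j + 1) m).coeff (j + 1)‖
              + ‖(powRem z j (m + 1)).coeff j‖ := by
              rw [← norm_mul]; exact norm_add_le _ _
          _ ≤ r * (hookDim (j + 1) m (j + 1) * r ^ (j + m - j))
              + hookDim j (m + 1) j * r ^ (j + m - j + 1) := by gcongr
          _ = _ := by push_cast; ring
      · have h3 := ih2 (j + 1) hz' h
        rw [e4] at h3
        rw [hookDim_succ_succ m h]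
        calc _ ≤ ‖z (n + 1)‖ * ‖(powRem z (n + 1) m).coeff (j + 1)‖
              + ‖(powRem z n (m + 1)).coeff j‖
              + ‖z (n + 1)‖ * ‖(powRem z n (m + 1)).coeff (j + 1)‖ := by
              rw [← norm_mul, ← norm_mul]
              exact (norm_sub_le _ _).trans (add_le_add_left (norm_add_le _ _) _)
          _ ≤ r * (hookDim (n + 1) m (j + 1) * r ^ (n + m - j))
              + hookDim n (m + 1) j * r ^ (n + m - j + 1)
              + r * (hookDim n (m + 1) (j + 1) * r ^ (n + m - j)) := by gcongr
          _ = _ := by push_cast; ring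

/-- For nonnegative nodes all terms of the coefficient recursion carry the sign `(-1) ^ (n + j)`, so
nothing cancels and the upper bound is matched from below. -/
theorem le_powRem_coeff (z : ℕ → ℝ) (s : ℝ) (hs : 0 ≤ s) (n m j : ℕ) (hz : ∀ i ≤ n, s ≤ z i)
    (hj : j ≤ n) :
    hookDim n m j * s ^ (n + m - j) ≤ (-1) ^ (n + j) * (powRem z n m).coeff j := by
  induction n, m using powRem.induct generalizing j with
  | case1 m =>
    obtain rfl : j = 0 := by omega
    rw [powRem, Polynomial.coeff_C_zero]
    simpa [hookDim_zero_left] using pow_le_pow_left₀ hs (hz 0 le_rfl) m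
  | case2 n =>
    rw [powRem, Polynomial.coeff_X_pow, hookDim_zero_right hj]
    split_ifs with h
    · subst h; simp [Even.neg_one_pow ⟨_, rfl⟩]
    · simp
  | case3 n m ih1 ih2 =>
    simp only [Nat.succ_eq_add_one] at *
    have hz' : ∀ i ≤ n, s ≤ z i := fun i hi => hz i (by omega)
    have h0 := hz (n + 1) le_rfl
    have hz0 : 0 ≤ z (n + 1) := hs.trans h0
    rcases j with _ | j
    · have h1 := ih1 0 hz (by omega)
      have h2 := ih2 0 hz' (by omega)
      rw [powRem_coeff_zero, hookDim_succ_zero]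
      calc _ = s * (hookDim (n + 1) m 0 * s ^ (n + 1 + m - 0))
            + s * (hookDim n (m + 1) 0 * s ^ (n + (m + 1) - 0)) := by
            push_cast; simp only [Nat.sub_zero]; ring
        _ ≤ z (n + 1) * ((-1) ^ (n + 1 + 0) * (powRem z (n + 1) m).coeff 0)
            + z (n + 1) * ((-1) ^ (n + 0) * (powRem z n (m + 1)).coeff 0) := by gcongr
        _ = _ := by ring
    · have e1 : n + 1 + (m + 1) - (j + 1) = n + m + 1 - j := by omega
      have e2 : n + 1 + m - (j + 1) = n + m - j := by omega
      have e3 : n + (m + 1) - j = n + m + 1 - j := by omega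
      have e4 : n + (m + 1) - (j + 1) = n + m - j := by omega
      have e5 : n + m + 1 - j = n + m - j + 1 := by omega
      have h1 := ih1 (j + 1) hz hj
      have h2 := ih2 j hz' (by omega)
      rw [powRem_coeff_succ]
      rw [e2] at h1
      rw [e3, e5] at h2
      rw [e1, e5]
      rcases Nat.lt_or_ge n (j + 1) with h | h
      · obtain rfl : j = n := by omega
        rw [powRem_coeff_eq_zero z j (m + 1) (j + 1) (by omega), mul_zero, sub_zero,
          hookDim_succ_top]
        calc _ = s * (hookDim (j + 1) m (j + 1) * s ^ (j + m - j))
              + hookDim j (m + 1) j * s ^ (j + m - j + 1) := by push_cast; ring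
          _ ≤ z (j + 1) * ((-1) ^ (j + 1 + (j + 1)) * (powRem z (j + 1) m).coeff (j + 1))
              + (-1) ^ (j + j) * (powRem z j (m + 1)).coeff j := by gcongr
          _ = _ := by ring
      · have h3 := ih2 (j + 1) hz' h
        rw [e4] at h3
        rw [hookDim_succ_succ m h]
        calc _ = s * (hookDim (n + 1) m (j + 1) * s ^ (n + m - j))
              + hookDim n (m + 1) j * s ^ (n + m - j + 1)
              + s * (hookDim n (m + 1) (j + 1) * s ^ (n + m - j)) := by push_cast; ring
          _ ≤ z (n + 1) * ((-1) ^ (n + 1 + (j + 1)) * (powRem z (n + 1) m).coeff (j + 1))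
              + (-1) ^ (n + j) * (powRem z n (m + 1)).coeff j
              + z (n + 1) * ((-1) ^ (n + (j + 1)) * (powRem z n (m + 1)).coeff (j + 1)) := by
              gcongr
          _ = _ := by ring

end HadamardCube

/-! ### Entrywise polynomials and positivity above the threshold. -/

namespace HadamardCube

open Matrix Polynomial

/-- Entrywise evaluation of a real polynomial at a complex matrix. -/
noncomputable def polyMap {n : Type*} (p : ℝ[X]) (A : Matrix n n ℂ) : Matrix n n ℂ :=
  A.map fun w => aeval w p

theorem isHermitian_polyMap {n : Type*} (p : ℝ[X]) {A : Matrix n n ℂ} (hA : A.IsHermitian) :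
    (polyMap p A).IsHermitian := by
  ext i j
  have h := hA.apply i j
  simp only [polyMap, conjTranspose_apply, map_apply, ← h]
  simp [← starRingEnd_apply, Polynomial.aeval_conj]

theorem quadForm_eq_sum {n : Type*} [Fintype n] (A : Matrix n n ℂ) (x : n → ℂ) :
    star x ⬝ᵥ (A *ᵥ x) = ∑ i, ∑ j, star (x i) * A i j * x j := by
  simp [dotProduct, mulVec, Finset.mul_sum, mul_assoc]

theorem posSemidef_of_re_nonneg {n : Type*} [Fintype n] {A : Matrix n n ℂ} (hA : A.IsHermitian)
    (h : ∀ x : n → ℂ, 0 ≤ (star x ⬝ᵥ (A *ᵥ x)).re) : A.PosSemidef := by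
  refine .of_dotProduct_mulVec_nonneg hA fun x => ?_
  rw [Complex.nonneg_iff]
  exact ⟨h x, (hA.im_star_dotProduct_mulVec_self x).symm⟩

theorem quadForm_vecMulVec {n : Type*} [Fintype n] (v x : n → ℂ) :
    star x ⬝ᵥ (vecMulVec v (star v) *ᵥ x) = ((‖star x ⬝ᵥ v‖ ^ 2 : ℝ) : ℂ) := by
  have : star v ⬝ᵥ x = star (star x ⬝ᵥ v) := by
    simp [dotProduct, mul_comm]
  rw [vecMulVec_mulVec, dotProduct_smul, this]
  simp [← Complex.mul_conj']

/-- The real quadratic form is monotone along `A + s • B` if the derivative has a positive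
semidefinite Hadamard product with `B`. -/
theorem posSemidef_polyMap_add {n : Type*} [Fintype n] (p : ℝ[X]) {A B : Matrix n n ℂ}
    (hA : A.IsHermitian) (hB : B.IsHermitian) (h0 : (polyMap p A).PosSemidef)
    (h : ∀ s : ℝ, 0 ≤ s → s ≤ 1 → (B ⊙ polyMap (derivative p) (A + s • B)).PosSemidef) :
    (polyMap p (A + B)).PosSemidef := by
  refine posSemidef_of_re_nonneg (isHermitian_polyMap p (hA.add hB)) fun x => ?_
  set g : ℝ → ℂ := fun s => star x ⬝ᵥ (polyMap p (A + s • B) *ᵥ x) with hg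
  have hder : ∀ s : ℝ, HasDerivAt g
      (star x ⬝ᵥ ((B ⊙ polyMap (derivative p) (A + s • B)) *ᵥ x)) s := by
    intro s
    simp only [hg, quadForm_eq_sum]
    refine HasDerivAt.fun_sum fun i _ => HasDerivAt.fun_sum fun j _ => ?_
    have h1 : HasDerivAt (fun s : ℝ => A i j + (s : ℂ) * B i j) (B i j) s := by
      simpa using ((Complex.ofRealCLM.hasDerivAt (x := s)).mul_const (B i j)).const_add (A i j)
    have h2 := (Polynomial.hasDerivAt_aeval p (A i j + (s : ℂ) * B i j)).comp s h1
    have h3 := (h2.const_mul (star (x i))).mul_const (x j)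
    refine h3.congr_deriv ?_
    simp only [polyMap, hadamard_apply, map_apply, Matrix.add_apply, Matrix.smul_apply,
      Complex.real_smul]
    ring
  have hre : ∀ s : ℝ, HasDerivAt (fun s => (g s).re)
      (star x ⬝ᵥ ((B ⊙ polyMap (derivative p) (A + s • B)) *ᵥ x)).re s := fun s =>
    Complex.reCLM.hasFDerivAt.comp_hasDerivAt s (hder s)
  have hmono : MonotoneOn (fun s => (g s).re) (Set.Icc 0 1) := by
    refine monotoneOn_of_deriv_nonneg (convex_Icc 0 1)
      (fun s _ => (hre s).continuousAt.continuousWithinAt)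
      (fun s _ => (hre s).differentiableAt.differentiableWithinAt) fun s hs => ?_
    rw [interior_Icc] at hs
    rw [(hre s).deriv]
    exact (Complex.nonneg_iff.1 ((h s hs.1.le hs.2.le).dotProduct_mulVec_nonneg x)).1
  have h1 := hmono (Set.left_mem_Icc.2 zero_le_one) (Set.right_mem_Icc.2 zero_le_one) zero_le_one
  have h2 := (Complex.nonneg_iff.1 (h0.dotProduct_mulVec_nonneg x)).1
  simp only [hg, zero_smul, add_zero, one_smul] at h1
  exact h2.trans h1

/-- A positive semidefinite matrix splits as a rank-one matrix plus a positive semidefinite matrix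
whose zeroth row vanishes. -/
theorem exists_rankOne_split {N : ℕ} {A : Matrix (Fin (N + 1)) (Fin (N + 1)) ℂ}
    (hA : A.PosSemidef) : ∃ (v : Fin (N + 1) → ℂ) (B : Matrix (Fin (N + 1)) (Fin (N + 1)) ℂ),
      B.PosSemidef ∧ (∀ j, B 0 j = 0) ∧ A = vecMulVec v (star v) + B := by
  have hd : 0 ≤ A 0 0 := hA.diag_nonneg
  have hher : ∀ i j, star (A j i) = A i j := fun i j => hA.1.apply i j
  have hd0 : A 0 0 = ((A 0 0).re : ℂ) := by
    rw [Complex.nonneg_iff] at hd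
    apply Complex.ext <;> simp [← hd.2]
  have hd1 : 0 ≤ (A 0 0).re := (Complex.nonneg_iff.1 hd).1
  set d : ℝ := (A 0 0).re with hdd
  -- A zero corner forces a zero column, by a `2 × 2` minor; divisions by `d = 0` below are then
  -- harmless.
  have hzero : d = 0 → ∀ i, A i 0 = 0 := by
    intro h i
    have h1 := (hA.submatrix ![i, 0]).det_nonneg
    rw [det_fin_two] at h1
    simp only [submatrix_apply, cons_val_zero, cons_val_one] at h1
    rw [hd0, h, ← hher 0 i, ← starRingEnd_apply, Complex.mul_conj'] at h1
    have h2 : -((‖A i 0‖ : ℂ) ^ 2) = ((-(‖A i 0‖ ^ 2) : ℝ) : ℂ) := by push_cast; ring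
    simp only [Complex.ofReal_zero, mul_zero, zero_sub] at h1
    rw [h2, Complex.zero_le_real] at h1
    have : ‖A i 0‖ ^ 2 = 0 := le_antisymm (by linarith) (by positivity)
    simpa using this
  have hsq : ((Real.sqrt d : ℝ) : ℂ) * ((Real.sqrt d : ℝ) : ℂ) = (d : ℂ) := by
    rw [← Complex.ofReal_mul, Real.mul_self_sqrt hd1]
  -- Congruence by this elimination matrix leaves the Schur complement of the corner, bordered by
  -- zeros.
  let P : Matrix (Fin (N + 1)) (Fin (N + 1)) ℂ :=
    1 - vecMulVec (Pi.single 0 1) (fun j => A 0 j / d)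
  have hAP : ∀ i j, (A * P) i j = A i j - A i 0 * (A 0 j / d) := by
    intro i j
    simp [P, mul_sub, mul_vecMulVec, vecMulVec_apply]
  have hB : ∀ i j, (Pᴴ * A * P) i j = A i j - A i 0 * A 0 j / d := by
    intro i j
    have hPH : Pᴴ = 1 - vecMulVec (fun i => A i 0 / d) (Pi.single 0 1) := by
      rw [conjTranspose_sub, conjTranspose_one, conjTranspose_vecMulVec]
      congr 2
      · ext i
        simp only [Pi.star_apply, star_div₀, hher]
        rw [show star (d : ℂ) = (d : ℂ) from Complex.conj_ofReal _]
      · simp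
    have : Pᴴ * A * P = A * P - vecMulVec (fun i => A i 0 / d) (fun j => (A * P) 0 j) := by
      rw [Matrix.mul_assoc, hPH, sub_mul, one_mul, vecMulVec_mul]
      congr 2
      ext j
      simp
    rw [this, Matrix.sub_apply, vecMulVec_apply, hAP, hAP]
    by_cases h : d = 0
    · simp [hzero h]
    · have : (d : ℂ) ≠ 0 := by exact_mod_cast h
      rw [hd0]
      field_simp
      ring
  refine ⟨fun i => A i 0 / Real.sqrt d, Pᴴ * A * P, hA.conjTranspose_mul_mul_same P, ?_, ?_⟩
  · intro j
    rw [hB]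
    by_cases h : d = 0
    · rw [← hher 0 j, hzero h]; simp
    · have : (d : ℂ) ≠ 0 := by exact_mod_cast h
      rw [hd0]
      field_simp
      ring
  · ext i j
    rw [Matrix.add_apply, hB, vecMulVec_apply]
    simp only [Pi.star_apply, star_div₀, hher]
    rw [show star ((Real.sqrt d : ℝ) : ℂ) = ((Real.sqrt d : ℝ) : ℂ) from Complex.conj_ofReal _,
      div_mul_div_comm, hsq]
    ring

/-- The polynomial `t * ∑ j, c j X ^ j - X ^ D`. -/
noncomputable def thresholdPoly {N : ℕ} (c : Fin N → ℝ) (t : ℝ) (D : ℕ) : ℝ[X] :=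
  ∑ j : Fin N, C (t * c j) * X ^ (j : ℕ) - X ^ D

theorem aeval_thresholdPoly {N : ℕ} (c : Fin N → ℝ) (t : ℝ) (D : ℕ) (w : ℂ) :
    aeval w (thresholdPoly c t D) = ∑ j : Fin N, ((t * c j : ℝ) : ℂ) * w ^ (j : ℕ) - w ^ D := by
  simp [thresholdPoly]

theorem threshold_eq_sum_hookDim {n : ℕ} (c : Fin (n + 1) → ℝ) (m : ℕ) (ρ : ℝ) :
    threshold c (n + m) ρ
      = ∑ j : Fin (n + 1), (hookDim n m j : ℝ) ^ 2 * (ρ ^ (n + m - (j : ℕ)) / c j) := by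
  refine Finset.sum_congr rfl fun j _ => ?_
  rw [hookDim, show n + 1 - (j : ℕ) - 1 = n - j by omega, Nat.cast_mul, mul_pow]

theorem hookDim_pos {n m j : ℕ} (hm : 1 ≤ m) (hj : j ≤ n) : 0 < hookDim n m j :=
  Nat.mul_pos (Nat.choose_pos (by omega)) (Nat.choose_pos (by omega))

theorem threshold_pos {N : ℕ} (hN : 1 ≤ N) {c : Fin N → ℝ} (hc : ∀ j, 0 < c j) {D : ℕ}
    (hD : N ≤ D) {ρ : ℝ} (hρ : 0 < ρ) : 0 < threshold c D ρ := by
  obtain ⟨n, rfl⟩ := Nat.exists_eq_add_of_le' hN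
  obtain ⟨m, rfl⟩ := Nat.exists_eq_add_of_le hD
  rw [add_assoc, threshold_eq_sum_hookDim]
  refine Finset.sum_pos (fun j _ => ?_) Finset.univ_nonempty
  have h1 := hc j
  have h2 : 0 < hookDim n (1 + m) j := hookDim_pos (by omega) (by omega)
  positivity

theorem posSemidef_thresholdPoly_rankOne {n m : ℕ} {c : Fin (n + 1) → ℝ}
    (hc : ∀ j, 0 < c j) {ρ t : ℝ} (hρ : 0 ≤ ρ) (ht : threshold c (n + m) ρ ≤ t)
    (v : Fin (n + 1) → ℂ) (hv : ∀ i, ‖v i‖ ^ 2 ≤ ρ) :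
    (polyMap (thresholdPoly c t (n + m)) (vecMulVec v (star v))).PosSemidef := by
  refine posSemidef_of_re_nonneg
    (isHermitian_polyMap _ (posSemidef_vecMulVec_self_star v).1) fun x => ?_
  have hpow : ∀ k : ℕ, ∀ i j, (vecMulVec v (star v) i j) ^ k
      = vecMulVec (v ^ k) (star (v ^ k)) i j := by
    intro k i j; simp [vecMulVec_apply, mul_pow]
  have hM : polyMap (thresholdPoly c t (n + m)) (vecMulVec v (star v))
      = ∑ j : Fin (n + 1), ((t * c j : ℝ) : ℂ) • vecMulVec (v ^ (j : ℕ)) (star (v ^ (j : ℕ)))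
        - vecMulVec (v ^ (n + m)) (star (v ^ (n + m))) := by
    ext i j
    rw [Matrix.sub_apply, Matrix.sum_apply, polyMap, map_apply, aeval_thresholdPoly]
    simp only [hpow, Matrix.smul_apply, smul_eq_mul]
  set y : ℕ → ℂ := fun k => star x ⬝ᵥ (v ^ k) with hy
  have hq : star x ⬝ᵥ (polyMap (thresholdPoly c t (n + m)) (vecMulVec v (star v)) *ᵥ x)
      = ((∑ j : Fin (n + 1), t * c j * ‖y j‖ ^ 2 - ‖y (n + m)‖ ^ 2 : ℝ) : ℂ) := by
    rw [hM, sub_mulVec, dotProduct_sub, quadForm_vecMulVec, sum_mulVec, dotProduct_sum]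
    simp only [smul_mulVec, dotProduct_smul, quadForm_vecMulVec, smul_eq_mul]
    push_cast
    rfl
  rw [hq, Complex.ofReal_re, sub_nonneg]
  set z : ℕ → ℂ := fun k => if h : k < n + 1 then v ⟨k, h⟩ else 0 with hz
  have hzv : ∀ i : Fin (n + 1), z i = v i := fun i => dif_pos i.isLt
  set a : ℕ → ℂ := fun j => (powRem z n m).coeff j with ha
  -- The interpolation identity at each node `v i`, paired with `x`.
  have hsum : y (n + m) = ∑ j : Fin (n + 1), a j * y j := by
    simp only [hy, dotProduct, Finset.mul_sum]
    rw [Finset.sum_comm]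
    refine Finset.sum_congr rfl fun i _ => ?_
    have h1 := powRem_eval z n m i (by omega)
    rw [powRem_eval_eq_sum, hzv, Finset.sum_range] at h1
    rw [Pi.pow_apply, ← h1, Finset.mul_sum]
    refine Finset.sum_congr rfl fun j _ => ?_
    rw [Pi.pow_apply]; ring
  have hbound : ∀ j : Fin (n + 1),
      ‖a j‖ ^ 2 ≤ (hookDim n m j : ℝ) ^ 2 * ρ ^ (n + m - (j : ℕ)) := by
    intro j
    have h1 := norm_powRem_coeff_le z (Real.sqrt ρ) n m j (fun i hi => by
      have h2 := hzv ⟨i, by omega⟩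
      rw [h2]
      exact Real.le_sqrt_of_sq_le (hv _)) (by omega)
    calc ‖a j‖ ^ 2 ≤ (hookDim n m j * Real.sqrt ρ ^ (n + m - (j : ℕ))) ^ 2 := by gcongr
      _ = _ := by rw [mul_pow, ← pow_mul, mul_comm _ 2, pow_mul, Real.sq_sqrt hρ]
  have hcs : ‖y (n + m)‖ ^ 2
      ≤ (∑ j : Fin (n + 1), ‖a j‖ ^ 2 / c j) * ∑ j : Fin (n + 1), c j * ‖y j‖ ^ 2 := by
    have h1 : ‖y (n + m)‖ ≤ ∑ j : Fin (n + 1), ‖a j‖ * ‖y j‖ := by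
      rw [hsum]
      exact (norm_sum_le _ _).trans_eq (Finset.sum_congr rfl fun j _ => norm_mul _ _)
    refine (pow_le_pow_left₀ (norm_nonneg _) h1 2).trans ?_
    refine Finset.sum_sq_le_sum_mul_sum_of_sq_le_mul _ (fun j _ => ?_) (fun j _ => ?_)
      fun j _ => ?_
    · have := hc j; positivity
    · have := hc j; positivity
    · have := (hc j).ne'
      exact le_of_eq (by field_simp)
  have hS : (∑ j : Fin (n + 1), ‖a j‖ ^ 2 / c j) ≤ t := by
    refine le_trans (Finset.sum_le_sum fun j _ => ?_)
      ((threshold_eq_sum_hookDim c m ρ).symm.trans_le ht)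
    rw [← mul_div_assoc]
    exact div_le_div_of_nonneg_right (hbound j) (hc j).le
  calc _ ≤ _ := hcs
    _ ≤ t * ∑ j : Fin (n + 1), c j * ‖y j‖ ^ 2 :=
      mul_le_mul_of_nonneg_right hS
        (Finset.sum_nonneg fun j _ => by have := hc j; positivity)
    _ = _ := by rw [Finset.mul_sum]; simp only [mul_assoc]

theorem posSemidef_of_submatrix_succ {N : ℕ} {A : Matrix (Fin (N + 1)) (Fin (N + 1)) ℂ}
    (hA : A.IsHermitian) (h0 : ∀ j, A 0 j = 0)
    (h : (A.submatrix Fin.succ Fin.succ).PosSemidef) : A.PosSemidef := by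
  refine .of_dotProduct_mulVec_nonneg hA fun x => ?_
  have h0' : ∀ j, A j 0 = 0 := fun j => by rw [← hA.apply, h0, star_zero]
  have := h.dotProduct_mulVec_nonneg fun i => x i.succ
  rw [quadForm_eq_sum] at this ⊢
  simpa [Fin.sum_univ_succ, h0, h0'] using this

/-- Differentiation kills the constant term, so the family is stable with one weight fewer; this
drives the induction on the size. -/
theorem derivative_thresholdPoly {n : ℕ} (c : Fin (n + 1) → ℝ) (t : ℝ) (E : ℕ) :
    derivative (thresholdPoly c t (E + 1)) = C ((E + 1 : ℕ) : ℝ)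
      * thresholdPoly (fun j : Fin n => ((j : ℕ) + 1 : ℝ) * c j.succ) (t / (E + 1 : ℕ)) E := by
  have hE : ((E + 1 : ℕ) : ℝ) ≠ 0 := by positivity
  simp only [thresholdPoly, derivative_sub, Fin.sum_univ_succ, derivative_add, derivative_sum,
    mul_sub,
    Finset.mul_sum]
  congr 1
  · simp only [Fin.val_zero, pow_zero, mul_one, derivative_C, zero_add]
    refine Finset.sum_congr rfl fun j _ => ?_
    rw [derivative_C_mul_X_pow, ← mul_assoc, ← C_mul, Fin.val_succ, Nat.add_sub_cancel]
    congr 2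
    field_simp
    push_cast
    ring
  · rw [derivative_X_pow, Nat.add_sub_cancel, map_natCast]

/-- Guarantees that `t / (E + 1)` is admissible for the derivative. Termwise after a shift of `j`:
the absorption identity cancels the weight `j + 1`, and the second binomials agree. -/
theorem mul_threshold_le {n : ℕ} {c : Fin (n + 1) → ℝ} (hc : ∀ j, 0 < c j) (E : ℕ) {ρ : ℝ}
    (hρ : 0 ≤ ρ) : ((E + 1 : ℕ) : ℝ) * threshold (fun j : Fin n => ((j : ℕ) + 1 : ℝ) * c j.succ) E ρ
      ≤ threshold c (E + 1) ρ := by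
  rw [threshold, threshold, Fin.sum_univ_succ, Finset.mul_sum]
  refine le_add_of_nonneg_of_le (by have := hc 0; positivity) (Finset.sum_le_sum fun j _ => ?_)
  have hcj := hc j.succ
  have h1 : ((E + 1 : ℕ) : ℝ) * E.choose j = (E + 1).choose (j + 1) * ((j : ℕ) + 1 : ℝ) := by
    exact_mod_cast Nat.add_one_mul_choose_eq E j
  have h2 : (E.choose j : ℝ) ≤ (E + 1).choose (j + 1) := by
    rw [Nat.choose_succ_succ]; push_cast; linarith [Nat.cast_nonneg (α := ℝ) (E.choose (j + 1))]
  rw [Fin.val_succ, show E + 1 - ((j : ℕ) + 1) = E - j by omega,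
    show n + 1 - ((j : ℕ) + 1) = n - j by omega]
  set b : ℝ := (((E - (j : ℕ) - 1).choose (n - (j : ℕ) - 1) : ℕ) : ℝ)
  calc _ = (((E + 1 : ℕ) : ℝ) * E.choose j) * E.choose j * b ^ 2
        * (ρ ^ (E - (j : ℕ)) / (((j : ℕ) + 1 : ℝ) * c j.succ)) := by ring
    _ = (E + 1).choose (j + 1) * E.choose j * b ^ 2 * (ρ ^ (E - (j : ℕ)) / c j.succ) := by
      rw [h1]; field_simp
    _ ≤ (E + 1).choose (j + 1) * (E + 1).choose (j + 1) * b ^ 2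
        * (ρ ^ (E - (j : ℕ)) / c j.succ) := by gcongr
    _ = _ := by ring

/-- Above the threshold, `t * ∑ j, c j A^{∘j} - A^{∘D}` is positive semidefinite. -/
theorem posSemidef_thresholdPoly {N D : ℕ} (hD : N ≤ D) {c : Fin N → ℝ} (hc : ∀ j, 0 < c j)
    {ρ t : ℝ} (hρ : 0 ≤ ρ) (ht : threshold c D ρ ≤ t) {A : Matrix (Fin N) (Fin N) ℂ}
    (hA : A ∈ psdCone N (Metric.closedBall (0 : ℂ) ρ)) :
    (polyMap (thresholdPoly c t D) A).PosSemidef := by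
  induction N generalizing D t with
  | zero =>
    refine posSemidef_of_re_nonneg (isHermitian_polyMap _ hA.1.1) fun x => ?_
    simp
  | succ n ih =>
    obtain ⟨E, rfl⟩ : ∃ E, D = E + 1 := ⟨D - 1, by omega⟩
    obtain ⟨v, B, hB, hB0, rfl⟩ := exists_rankOne_split hA.1
    have hV := posSemidef_vecMulVec_self_star v
    have hball : ∀ i j, ‖vecMulVec v (star v) i j + B i j‖ ≤ ρ := fun i j => by
      simpa using hA.2 i j
    have hv : ∀ i, ‖v i‖ ^ 2 ≤ ρ := by
      intro i
      have h1 := Complex.nonneg_iff.1 (hB.diag_nonneg (i := i))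
      have h2 : vecMulVec v (star v) i i = ((‖v i‖ ^ 2 : ℝ) : ℂ) := by
        simp [vecMulVec_apply, ← Complex.mul_conj']
      have h3 := (Complex.re_le_norm _).trans (hball i i)
      rw [h2, Complex.add_re, Complex.ofReal_re] at h3
      linarith
    -- Both ends of the path lie in the disc, hence by convexity so does every `v v* + s B`.
    have hvij : ∀ i j, ‖vecMulVec v (star v) i j‖ ≤ ρ := by
      intro i j
      rw [vecMulVec_apply, norm_mul, Pi.star_apply, norm_star]
      nlinarith [hv i, hv j, sq_nonneg (‖v i‖ - ‖v j‖)]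
    refine posSemidef_polyMap_add _ hV.1 hB.1 ?_ fun s hs0 hs1 => ?_
    · obtain ⟨m, hm⟩ := Nat.exists_eq_add_of_le (show n ≤ E + 1 by omega)
      rw [hm] at ht ⊢
      exact posSemidef_thresholdPoly_rankOne hc hρ ht v hv
    · have hAs : (vecMulVec v (star v) + s • B).PosSemidef := hV.add (hB.smul hs0)
      -- The zero row of `B` survives the Hadamard product, so only the `n × n` corner matters, and
      -- there the induction hypothesis applies.
      refine posSemidef_of_submatrix_succ (hB.1.hadamard (isHermitian_polyMap _ hAs.1))
        (fun j => by simp [hadamard_apply, hB0]) ?_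
      have hsub : (polyMap (thresholdPoly (fun j : Fin n => ((j : ℕ) + 1 : ℝ) * c j.succ)
          (t / (E + 1 : ℕ)) E)
          ((vecMulVec v (star v) + s • B).submatrix Fin.succ Fin.succ)).PosSemidef := by
        refine ih (by omega) (fun j => by have := hc j.succ; positivity) ?_
          ⟨hAs.submatrix _, fun i j => ?_⟩
        · rw [le_div_iff₀' (by positivity)]
          exact (mul_threshold_le hc E hρ).trans ht
        · have hconv : (vecMulVec v (star v) + s • B) i.succ j.succ
              = (1 - s) • vecMulVec v (star v) i.succ j.succ
                + s • (vecMulVec v (star v) i.succ j.succ + B i.succ j.succ) := by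
            rw [Matrix.add_apply, Matrix.smul_apply]; module
          rw [submatrix_apply, hconv]
          exact (convex_closedBall (0 : ℂ) ρ) (by simpa using hvij _ _)
            (by simpa using hball _ _) (by linarith) hs0 (by ring)
      have key := (hB.submatrix Fin.succ).hadamard
        (hsub.smul (a := ((E + 1 : ℕ) : ℝ)) (by positivity))
      have heq : (B ⊙ polyMap (derivative (thresholdPoly c t (E + 1)))
          (vecMulVec v (star v) + s • B)).submatrix Fin.succ Fin.succ
          = B.submatrix Fin.succ Fin.succ ⊙ (((E + 1 : ℕ) : ℝ) •
            polyMap (thresholdPoly (fun j : Fin n => ((j : ℕ) + 1 : ℝ) * c j.succ)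
              (t / (E + 1 : ℕ)) E)
              ((vecMulVec v (star v) + s • B).submatrix Fin.succ Fin.succ)) := by
        ext i j
        simp only [submatrix_apply, hadamard_apply, Matrix.smul_apply, polyMap, map_apply,
          derivative_thresholdPoly, map_mul, aeval_C, Complex.real_smul]
        rfl
      rw [heq]
      exact key

/-! ### The matrix cube: sufficient and necessary bounds. -/

theorem hadamardPow_vecMulVec {N : ℕ} (v : Fin N → ℂ) (k : ℕ) :
    hadamardPow (vecMulVec v (star v)) k = vecMulVec (v ^ k) (star (v ^ k)) := by
  ext i j
  simp [hadamardPow, vecMulVec_apply, mul_pow]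

theorem posSemidef_hadamardPow {N : ℕ} {A : Matrix (Fin N) (Fin N) ℂ} (hA : A.PosSemidef)
    (k : ℕ) : (hadamardPow A k).PosSemidef := by
  induction k with
  | zero =>
    have h : hadamardPow A 0 = vecMulVec (1 : Fin N → ℂ) (star 1) := by
      ext i j; simp [hadamardPow, vecMulVec_apply]
    rw [h]
    exact posSemidef_vecMulVec_self_star _
  | succ k ih =>
    have h : hadamardPow A (k + 1) = hadamardPow A k ⊙ A := by
      ext i j; simp [hadamardPow, pow_succ]
    rw [h]
    exact ih.hadamard hA

theorem posSemidef_lowerPart {N : ℕ} {c : Fin N → ℝ} (hc : ∀ j, 0 < c j)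
    {A : Matrix (Fin N) (Fin N) ℂ} (hA : A.PosSemidef) : (lowerPart c A).PosSemidef :=
  posSemidef_sum _ fun j _ => (posSemidef_hadamardPow hA j).smul (hc j).le

theorem polyMap_thresholdPoly {N : ℕ} (c : Fin N → ℝ) (t : ℝ) (D : ℕ)
    (A : Matrix (Fin N) (Fin N) ℂ) :
    polyMap (thresholdPoly c t D) A = t • lowerPart c A - hadamardPow A D := by
  ext i j
  simp [polyMap, aeval_thresholdPoly, lowerPart, hadamardPow, Matrix.sum_apply, Finset.mul_sum,
    mul_assoc]

theorem hadamardCube_subset_psdCone {N M : ℕ} (hN : 1 ≤ N) {c : Fin N → ℝ} (hc : ∀ j, 0 < c j)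
    {ρ η : ℝ} (hρ : 0 < ρ) (hη : 0 < η)
    (h : η ≤ (∑ m ∈ Finset.range (M + 1), threshold c (N + m) ρ)⁻¹)
    {A : Matrix (Fin N) (Fin N) ℂ} (hA : A ∈ psdCone N (Metric.closedBall (0 : ℂ) ρ)) :
    hadamardCube M c A η ⊆ psdCone N Set.univ := by
  rintro B ⟨u, hu, rfl⟩
  refine ⟨?_, fun _ _ => Set.mem_univ _⟩
  have hT : 0 < ∑ m ∈ Finset.range (M + 1), threshold c (N + m) ρ :=
    Finset.sum_pos (fun m _ => threshold_pos hN hc (by omega) hρ) (by simp)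
  have h1 : η * ∑ m ∈ Finset.range (M + 1), threshold c (N + m) ρ ≤ 1 := by
    rwa [← le_div_iff₀ hT, one_div]
  -- Each direction takes the share `η * threshold` of the lower part, which pays for the worst
  -- coefficient `-η`; the leftovers have nonnegative coefficients.
  have hsplit : lowerPart c A + ∑ m : Fin (M + 1), u m • hadamardPow A (N + (m : ℕ))
      = (1 - η * ∑ m ∈ Finset.range (M + 1), threshold c (N + m) ρ) • lowerPart c A
        + ∑ m : Fin (M + 1), (η • polyMap (thresholdPoly c (threshold c (N + m) ρ) (N + m)) A
          + (η + u m) • hadamardPow A (N + (m : ℕ))) := by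
    have h2 : ∀ m : Fin (M + 1),
        η • polyMap (thresholdPoly c (threshold c (N + m) ρ) (N + m)) A
          + (η + u m) • hadamardPow A (N + (m : ℕ))
        = (η * threshold c (N + m) ρ) • lowerPart c A + u m • hadamardPow A (N + (m : ℕ)) := by
      intro m
      rw [polyMap_thresholdPoly]
      module
    rw [Finset.sum_congr rfl fun m _ => h2 m, Finset.sum_add_distrib, ← Finset.sum_smul,
      ← Finset.mul_sum, Finset.sum_range]
    module
  rw [hsplit]
  refine ((posSemidef_lowerPart hc hA.1).smul (by linarith)).add (posSemidef_sum _ fun m _ => ?_)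
  refine ((posSemidef_thresholdPoly (by omega) hc hρ.le le_rfl hA).smul hη.le).add
    ((posSemidef_hadamardPow hA.1 _).smul ?_)
  linarith [(hu m).1]

theorem quadForm_lowerPart_vecMulVec {N : ℕ} (c : Fin N → ℝ) (η : ℝ) (D : ℕ) (v x : Fin N → ℝ) :
    (star (fun i => (x i : ℂ)) ⬝ᵥ ((lowerPart c (vecMulVec (fun i => (v i : ℂ))
        (star fun i => (v i : ℂ))) + (-η) • hadamardPow (vecMulVec (fun i => (v i : ℂ))
        (star fun i => (v i : ℂ))) D) *ᵥ fun i => (x i : ℂ))).re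
      = ∑ j : Fin N, c j * (∑ i, x i * v i ^ (j : ℕ)) ^ 2 - η * (∑ i, x i * v i ^ D) ^ 2 := by
  have hk : ∀ k : ℕ, star (fun i => (x i : ℂ)) ⬝ᵥ (hadamardPow (vecMulVec (fun i => (v i : ℂ))
      (star fun i => (v i : ℂ))) k *ᵥ fun i => (x i : ℂ))
      = (((∑ i, x i * v i ^ k) ^ 2 : ℝ) : ℂ) := by
    intro k
    have : star (fun i => (x i : ℂ)) ⬝ᵥ ((fun i => (v i : ℂ)) ^ k)
        = ((∑ i, x i * v i ^ k : ℝ) : ℂ) := by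
      simp [dotProduct]
    rw [hadamardPow_vecMulVec, quadForm_vecMulVec, this, Complex.norm_real, Real.norm_eq_abs,
      sq_abs]
  rw [add_mulVec, dotProduct_add, lowerPart, sum_mulVec, dotProduct_sum]
  simp only [smul_mulVec, dotProduct_smul, hk, Complex.real_smul, ← Complex.ofReal_mul]
  rw [← Complex.ofReal_sum, ← Complex.ofReal_add, Complex.ofReal_re]
  ring

/-- Testing the cube at rank-one matrices with distinct entries in `[s, √ρ]`. -/
theorem mul_threshold_sq_le_one {n M : ℕ} {c : Fin (n + 1) → ℝ} (hc : ∀ j, 0 < c j)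
    {ρ η s : ℝ} (hη : 0 < η) (hs : 0 ≤ s) (hsρ : s < Real.sqrt ρ) (hρ : 0 ≤ ρ)
    (h : ∀ A ∈ psdCone (n + 1) (Metric.closedBall (0 : ℂ) ρ),
      hadamardCube M c A η ⊆ psdCone (n + 1) Set.univ) :
    η * threshold c (n + 1 + M) (s ^ 2) ≤ 1 := by
  -- Distinct nodes make the Vandermonde matrix invertible, so the moments of `x` can be prescribed.
  set z : ℕ → ℝ := fun i => s + (Real.sqrt ρ - s) / (n + 1) * i with hz
  have hstep : 0 < (Real.sqrt ρ - s) / (n + 1) := div_pos (by linarith) (by positivity)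
  have hzs : ∀ i, s ≤ z i := fun i => by
    have : 0 ≤ (Real.sqrt ρ - s) / (n + 1) * i := by positivity
    simp only [hz]; linarith
  have hzρ : ∀ i ≤ n, z i ≤ Real.sqrt ρ := fun i hi => by
    have h1 : (Real.sqrt ρ - s) / (n + 1) * i ≤ (Real.sqrt ρ - s) / (n + 1) * (n + 1) := by
      have : (i : ℝ) ≤ n + 1 := by exact_mod_cast (by omega : i ≤ n + 1)
      gcongr
    rw [div_mul_cancel₀ _ (by positivity)] at h1
    simp only [hz]; linarith
  have hzinj : Function.Injective fun i : Fin (n + 1) => z i := by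
    intro i j hij
    have h1 : (Real.sqrt ρ - s) / (n + 1) * (i : ℕ) = (Real.sqrt ρ - s) / (n + 1) * (j : ℕ) := by
      simpa [hz] using hij
    exact Fin.ext (by exact_mod_cast mul_left_cancel₀ hstep.ne' h1)
  set v : Fin (n + 1) → ℂ := fun i => (z i : ℂ) with hv
  set a : ℕ → ℝ := fun j => (powRem z n (1 + M)).coeff j with ha
  have hdet : IsUnit (vandermonde fun i : Fin (n + 1) => z i).det :=
    (det_vandermonde_ne_zero_iff.2 hzinj).isUnit
  -- Moments `a j / c j` are the equality case of the weighted Cauchy–Schwarz inequality.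
  obtain ⟨x, hx⟩ : ∃ x : Fin (n + 1) → ℝ,
      ∀ j : Fin (n + 1), ∑ i : Fin (n + 1), x i * z i ^ (j : ℕ) = a j / c j := by
    refine ⟨(fun j : Fin (n + 1) => a j / c j) ᵥ* (vandermonde fun i : Fin (n + 1) => z i)⁻¹,
      fun j => ?_⟩
    have h1 : ((fun j : Fin (n + 1) => a j / c j) ᵥ* (vandermonde fun i : Fin (n + 1) => z i)⁻¹)
        ᵥ* (vandermonde fun i : Fin (n + 1) => z i) = fun j : Fin (n + 1) => a j / c j := by
      rw [vecMul_vecMul, nonsing_inv_mul _ hdet, vecMul_one]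
    simpa [vecMul, dotProduct, vandermonde_apply] using congrFun h1 j
  have hmem : vecMulVec v (star v) ∈ psdCone (n + 1) (Metric.closedBall (0 : ℂ) ρ) := by
    refine ⟨posSemidef_vecMulVec_self_star v, fun i j => ?_⟩
    rw [mem_closedBall_zero_iff, vecMulVec_apply, norm_mul, Pi.star_apply, norm_star]
    simp only [hv, Complex.norm_real, Real.norm_eq_abs, abs_of_nonneg (hs.trans (hzs _))]
    calc z i * z j ≤ Real.sqrt ρ * Real.sqrt ρ :=
          mul_le_mul (hzρ i (by omega)) (hzρ j (by omega)) (hs.trans (hzs _)) (Real.sqrt_nonneg _)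
      _ = ρ := Real.mul_self_sqrt hρ
  have hcube : lowerPart c (vecMulVec v (star v))
      + (-η) • hadamardPow (vecMulVec v (star v)) (n + 1 + M)
      ∈ hadamardCube M c (vecMulVec v (star v)) η := by
    -- Only the highest power is perturbed, which is why a single threshold appears.
    refine ⟨fun m => if m = Fin.last M then -η else 0, fun m => ?_, ?_⟩
    · dsimp only
      split_ifs <;> constructor <;> linarith
    · simp [ite_smul]
  have hpos := (Complex.nonneg_iff.1
    ((h _ hmem hcube).1.dotProduct_mulVec_nonneg fun i => (x i : ℂ))).1
  rw [quadForm_lowerPart_vecMulVec c η (n + 1 + M) (fun i : Fin (n + 1) => z i) x] at hpos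
  set S : ℝ := ∑ j : Fin (n + 1), a j ^ 2 / c j with hS
  have h1 : ∑ j : Fin (n + 1), c j * (∑ i : Fin (n + 1), x i * z i ^ (j : ℕ)) ^ 2 = S := by
    refine Finset.sum_congr rfl fun j _ => ?_
    have := (hc j).ne'
    rw [hx]; field_simp
  have h2 : ∑ i : Fin (n + 1), x i * z i ^ (n + 1 + M) = S := by
    have h3 : ∀ i : Fin (n + 1), x i * z i ^ (n + 1 + M)
        = ∑ j : Fin (n + 1), a j * (x i * z i ^ (j : ℕ)) := by
      intro i
      rw [add_assoc, ← powRem_eval z n (1 + M) i (by omega), powRem_eval_eq_sum, Finset.sum_range,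
        Finset.mul_sum]
      exact Finset.sum_congr rfl fun j _ => by ring
    rw [Finset.sum_congr rfl fun i _ => h3 i, Finset.sum_comm]
    refine Finset.sum_congr rfl fun j _ => ?_
    rw [← Finset.mul_sum, hx]; ring
  -- Positivity now reads `0 ≤ S - η * S ^ 2`, which rules out `η * S > 1`.
  rw [h1, h2] at hpos
  have hTS : threshold c (n + 1 + M) (s ^ 2) ≤ S := by
    rw [add_assoc, threshold_eq_sum_hookDim]
    refine Finset.sum_le_sum fun j _ => ?_
    have h3 := le_powRem_coeff z s hs n (1 + M) j (fun i _ => hzs i) (by omega)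
    have h4 : (hookDim n (1 + M) j * s ^ (n + (1 + M) - (j : ℕ))) ^ 2 ≤ a j ^ 2 := by
      calc _ ≤ ((-1) ^ (n + (j : ℕ)) * a j) ^ 2 := pow_le_pow_left₀ (by positivity) h3 2
        _ = a j ^ 2 := by rw [mul_pow, ← pow_mul, mul_comm _ 2, pow_mul]; simp
    rw [← mul_div_assoc, ← pow_mul, mul_comm 2, pow_mul, ← mul_pow]
    exact div_le_div_of_nonneg_right h4 (hc j).le
  refine (mul_le_mul_of_nonneg_left hTS hη.le).trans ?_
  by_contra hcon
  push Not at hcon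
  have hSpos : 0 < S := by
    by_contra hS0
    nlinarith
  nlinarith

/-- Distinct nodes exclude `s = √ρ`, so the bound comes from letting `s` increase to `√ρ`, by
continuity of the threshold. -/
theorem le_inv_threshold_of_subset {N M : ℕ} (hN : 1 ≤ N) {c : Fin N → ℝ} (hc : ∀ j, 0 < c j)
    {ρ η : ℝ} (hρ : 0 < ρ) (hη : 0 < η)
    (h : ∀ A ∈ psdCone N (Metric.closedBall (0 : ℂ) ρ),
      hadamardCube M c A η ⊆ psdCone N Set.univ) :
    η ≤ (threshold c (N + M) ρ)⁻¹ := by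
  rw [← one_div, le_div_iff₀ (threshold_pos hN hc (by omega) hρ)]
  obtain ⟨n, rfl⟩ := Nat.exists_eq_add_of_le' hN
  have hcont : Continuous fun s : ℝ => η * threshold c (n + 1 + M) (s ^ 2) := by
    unfold threshold
    fun_prop
  have hsqrt := Real.sqrt_pos.2 hρ
  have hlim := (hcont.tendsto (Real.sqrt ρ)).mono_left
    (nhdsWithin_le_nhds (s := Set.Iio (Real.sqrt ρ)))
  simp only [Real.sq_sqrt hρ.le] at hlim
  refine le_of_tendsto hlim ?_
  filter_upwards [Ioo_mem_nhdsLT hsqrt] with s hs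
  exact mul_threshold_sq_le_one hc hη hs.1.le hs.2 hρ.le h

end HadamardCube

/-! ### Growth of the threshold in the degree, and the limit. -/

namespace HadamardCube

/-- With `k = N - j - 1`, the ratio of the two products is exactly `(k+m+2)(m+1) /
((N+m+1)(k+m+1))`; the factor `2` absorbs `(k+m+2)/(k+m+1)`. -/
theorem mul_choose_mul_choose_le {N j : ℕ} (m : ℕ) (hj : j < N) :
    N * ((N + m).choose j * (N + m - j - 1).choose (N - j - 1))
      ≤ 2 * (m + 1) * ((N + (m + 1)).choose j * (N + (m + 1) - j - 1).choose (N - j - 1)) := by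
  obtain ⟨k, rfl⟩ := Nat.exists_eq_add_of_lt hj
  have h1 := Nat.choose_mul_succ_eq (j + k + 1 + m) j
  have h2 := Nat.choose_mul_succ_eq (k + m) k
  rw [show j + k + 1 + m + 1 - j = k + m + 2 by omega] at h1
  rw [show k + m + 1 - k = m + 1 by omega] at h2
  rw [show j + k + 1 + m - j - 1 = k + m by omega, show j + k + 1 - j - 1 = k by omega,
    show j + k + 1 + (m + 1) - j - 1 = k + m + 1 by omega, ← add_assoc (j + k + 1) m 1]
  set p := (j + k + 1 + m).choose j
  set q := (k + m).choose k
  set p' := (j + k + 1 + m + 1).choose j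
  set q' := (k + m + 1).choose k
  refine Nat.le_of_mul_le_mul_left (c := k + m + 1) ?_ (by omega)
  calc (k + m + 1) * ((j + k + 1) * (p * q))
      ≤ (k + m + 1) * ((j + k + 1 + m + 1) * (p * q)) :=
        Nat.mul_le_mul_left _ (Nat.mul_le_mul_right _ (by omega))
    _ = (p * (j + k + 1 + m + 1)) * (q * (k + m + 1)) := by ring
    _ = (k + m + 2) * (p' * q' * (m + 1)) := by rw [h1, h2]; ring
    _ ≤ (2 * (k + m + 1)) * (p' * q' * (m + 1)) := Nat.mul_le_mul_right _ (by omega)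
    _ = _ := by ring

/-- The comparison is termwise in `j`, so the weights play no role; this makes the limit uniform in
`c`. -/
theorem threshold_le_threshold_succ {N : ℕ} {c : Fin N → ℝ} (hc : ∀ j, 0 < c j) (m : ℕ) {ρ : ℝ}
    (hρ : 0 < ρ) : (N : ℝ) ^ 2 * ρ * threshold c (N + m) ρ
      ≤ (2 * (m + 1)) ^ 2 * threshold c (N + (m + 1)) ρ := by
  rw [threshold, threshold, Finset.mul_sum, Finset.mul_sum]
  refine Finset.sum_le_sum fun j _ => ?_
  have hcj := hc j
  have h1 : (N : ℝ) * (((N + m).choose j : ℝ) * ((N + m - j - 1).choose (N - j - 1) : ℕ))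
      ≤ 2 * (m + 1) * (((N + (m + 1)).choose j : ℝ)
        * ((N + (m + 1) - j - 1).choose (N - j - 1) : ℕ)) := by
    exact_mod_cast mul_choose_mul_choose_le m j.isLt
  have h2 := pow_le_pow_left₀ (by positivity) h1 2
  rw [show N + (m + 1) - (j : ℕ) = (N + m - (j : ℕ)) + 1 by omega] at h2 ⊢
  calc _ = ((N : ℝ) * (((N + m).choose j : ℝ) * ((N + m - j - 1).choose (N - j - 1) : ℕ))) ^ 2
        * (ρ ^ (N + m - (j : ℕ) + 1) / c j) := by ring
    _ ≤ _ := mul_le_mul_of_nonneg_right h2 (by positivity)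
    _ = _ := by ring

open Filter Topology in
theorem tendsto_threshold_ratio {ρ : ℝ} (hρ : 0 < ρ) {c : (N : ℕ) → Fin N → ℝ}
    (hc : ∀ N j, 0 < c N j) (M : ℕ) :
    Tendsto (fun N : ℕ => (threshold (c N) (N + M) ρ)⁻¹ *
      ∑ m ∈ Finset.range (M + 1), threshold (c N) (N + m) ρ) atTop (𝓝 1) := by
  have hpos : ∀ m N : ℕ, 1 ≤ N → 0 < threshold (c N) (N + m) ρ := fun m N hN =>
    threshold_pos hN (hc N) (by omega) hρ
  induction M with
  | zero =>
    refine tendsto_const_nhds.congr' ?_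
    filter_upwards [eventually_ge_atTop 1] with N hN
    simpa using (inv_mul_cancel₀ (hpos 0 N hN).ne').symm
  | succ M ih =>
    have hstep : Tendsto (fun N : ℕ => (threshold (c N) (N + (M + 1)) ρ)⁻¹
        * threshold (c N) (N + M) ρ) atTop (𝓝 0) := by
      have hbd : Tendsto (fun N : ℕ => (2 * (M + 1) : ℝ) ^ 2 / ρ * ((N : ℝ)⁻¹) ^ 2) atTop
          (𝓝 0) := by
        simpa using ((tendsto_inv_atTop_nhds_zero_nat (𝕜 := ℝ)).pow 2).const_mul
          ((2 * (M + 1) : ℝ) ^ 2 / ρ)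
      refine tendsto_of_tendsto_of_tendsto_of_le_of_le' tendsto_const_nhds hbd ?_ ?_
      · filter_upwards [eventually_ge_atTop 1] with N hN
        exact mul_nonneg (inv_nonneg.2 (hpos _ N hN).le) (hpos _ N hN).le
      · filter_upwards [eventually_ge_atTop 1] with N hN
        have h1 := threshold_le_threshold_succ (hc N) M hρ
        have h2 := hpos (M + 1) N hN
        have h3 : (0 : ℝ) < N := by exact_mod_cast hN
        rw [inv_mul_le_iff₀ h2]
        calc threshold (c N) (N + M) ρ
            = ((N : ℝ) ^ 2 * ρ)⁻¹ * ((N : ℝ) ^ 2 * ρ * threshold (c N) (N + M) ρ) := by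
              field_simp
          _ ≤ ((N : ℝ) ^ 2 * ρ)⁻¹ * ((2 * (M + 1)) ^ 2 * threshold (c N) (N + (M + 1)) ρ) := by
              gcongr
          _ = _ := by field_simp
    -- The ratio for `M + 1` is `1` plus the ratio for `M` times a factor tending to `0`.
    have hlim := (hstep.mul ih).add_const 1
    rw [zero_mul, zero_add] at hlim
    refine hlim.congr' ?_
    filter_upwards [eventually_ge_atTop 1] with N hN
    have h1 := (hpos M N hN).ne'
    have h2 := (hpos (M + 1) N hN).ne'
    rw [Finset.sum_range_succ _ (M + 1)]
    field_simp

end HadamardCube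

theorem corollary1p5 (ρ : ℝ) (hρ : 0 < ρ) (M : ℕ) :
    (∀ (N : ℕ), 1 ≤ N → ∀ c : Fin N → ℝ, (∀ j, 0 < c j) → ∀ η : ℝ, 0 < η →
      (η ≤ (∑ m ∈ Finset.range (M + 1), HadamardCube.threshold c (N + m) ρ)⁻¹ →
        ∀ A ∈ HadamardCube.psdCone N (Metric.closedBall (0 : ℂ) ρ),
          HadamardCube.hadamardCube M c A η ⊆ HadamardCube.psdCone N Set.univ) ∧
      ((∀ A ∈ HadamardCube.psdCone N (Metric.closedBall (0 : ℂ) ρ),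
          HadamardCube.hadamardCube M c A η ⊆ HadamardCube.psdCone N Set.univ) →
        η ≤ (HadamardCube.threshold c (N + M) ρ)⁻¹)) ∧
    (∀ c : (N : ℕ) → Fin N → ℝ, (∀ N j, 0 < c N j) →
      Filter.Tendsto
        (fun N : ℕ => (HadamardCube.threshold (c N) (N + M) ρ)⁻¹ *
          ∑ m ∈ Finset.range (M + 1), HadamardCube.threshold (c N) (N + m) ρ)
        Filter.atTop (nhds 1)) :=
  ⟨fun _ hN _ hc _ hη =>
    ⟨fun h _ hA => HadamardCube.hadamardCube_subset_psdCone hN hc hρ hη h hA,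
      HadamardCube.le_inv_threshold_of_subset hN hc hρ hη⟩,
    fun _ hc => HadamardCube.tendsto_threshold_ratio hρ hc M⟩
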